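/- For a set $X$ let $(\delta_x)_{x\in X}$ be the canonical orthonormal basis of the complex Hilbert space $\ell_2(X)$. For a metric space $(X,d)$, a bounded operator $a$ on $\ell_2(X)$ has finite propagation if there is $r>0$ with $\langle a\delta_x,\delta_y\rangle=0$ whenever $d(x,y)>r$; the uniform Roe algebra $\mathrm{C}^*_u(X)$ is the operator-norm closure in $\mathcal{B}(\ell_2(X))$ of the $*$-algebra of operators of finite propagation. The space $X$ is uniformly locally finite (u.l.f.) if $\sup_{x\in X}|B_r(x)|<\infty$ for all $r>0$. It is sparse if $X=\bigsqcup_{n\in\mathbb{N}}X_n$ with each $X_n$ finite (possibly empty) and $d(X_n,X_m)\to\infty$ as $n+m\to\infty$ with $n\neq m$ (distances to the empty set being $\infty$). An operator $a$ is a ghost if for all $\varepsilon>0$ there is a finite $A\subseteq X$ with $|\langle a\delta_x,\delta_y\rangle|<\varepsilon$ for all $x,y\in X\setminus A$. The space $X$ yields only compact ghost projections if every ghost projection (self-adjoint idempotent) in $\mathrm{C}^*_u(X)$ is compact. A minimal projection of a $\mathrm{C}^*$-algebra $A$ is a nonzero projection $p\in A$ with $pAp=\mathbb{C}p$. **Theorem.**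 Let $(X,d)$ and $(Y,\partial)$ be u.l.f. metric spaces, and assume that every sparse subspace of $Y$ (with the restricted metric) yields only compact ghost projections. Assume that there is a rank-preserving embedding $\Phi\colon \mathrm{C}^*_u(X)\to\mathrm{C}^*_u(Y)$, i.e. an injective (not necessarily unital) $*$-homomorphism that sends minimal projections to minimal projections. Then there exists a map $f\colon X\to Y$ which is uniformly finite-to-one, i.e. $\sup_{y\in Y}|f^{-1}(\{y\})|<\infty$, and coarse, i.e. $\sup\{\partial(f(x),f(x'))\mid d(x,x')\le r\}<\infty$ for all $r>0$. -/

import Mathlib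

noncomputable section

namespace UniformRoe

/-- The Hilbert space `ℓ₂(X)` of square summable complex families indexed by `X`. -/
abbrev Ell2 (X : Type*) : Type _ :=
  lp (fun _ : X => ℂ) 2

/-- The canonical orthonormal basis vector `δ_x` of `ℓ₂(X)`. -/
def delta {X : Type*} (x : X) : Ell2 X :=
  open Classical in lp.single 2 x (1 : ℂ)

/-- The matrix coefficient `⟨a δ_x, δ_y⟩` (inner product linear in the first variable; Mathlib's
inner product is linear in the second variable, so the arguments are swapped). -/
def entry {X : Type*} (a : Ell2 X →L[ℂ] Ell2 X) (x y : X) : ℂ :=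
  inner ℂ (delta y) (a (delta x))

/-- `a` has propagation at most `r`: `⟨a δ_x, δ_y⟩ = 0` whenever `d(x, y) > r`. -/
def PropagationLE {X : Type*} [MetricSpace X] (a : Ell2 X →L[ℂ] Ell2 X) (r : ℝ) : Prop :=
  ∀ x y : X, r < dist x y → entry a x y = 0

/-- `a` has finite propagation. -/
def FinitePropagation {X : Type*} [MetricSpace X] (a : Ell2 X →L[ℂ] Ell2 X) : Prop :=
  ∃ r : ℝ, 0 < r ∧ PropagationLE a r

section Facts

variable {X : Type*}

theorem inner_delta (x : X) (v : Ell2 X) : inner ℂ (delta x) v = v x := by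
  classical
  unfold delta
  rw [lp.inner_single_left]
  simp

theorem delta_apply_ne {x y : X} (h : y ≠ x) : (delta x : Ell2 X) y = 0 := by
  classical
  simp [delta, lp.single_apply, h]

theorem entry_eq (a : Ell2 X →L[ℂ] Ell2 X) (x y : X) : entry a x y = a (delta x) y :=
  inner_delta _ _

theorem entry_add (a b : Ell2 X →L[ℂ] Ell2 X) (x y : X) :
    entry (a + b) x y = entry a x y + entry b x y := by
  simp [entry]

theorem entry_star (a : Ell2 X →L[ℂ] Ell2 X) (x y : X) :
    entry (star a) x y = star (entry a y x) := by
  simp [entry, ContinuousLinearMap.star_eq_adjoint, ContinuousLinearMap.adjoint_inner_right]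

theorem entry_algebraMap (c : ℂ) {x y : X} (h : x ≠ y) :
    entry (algebraMap ℂ (Ell2 X →L[ℂ] Ell2 X) c) x y = 0 := by
  rw [entry_eq]
  simp [Algebra.algebraMap_eq_smul_one, delta_apply_ne h.symm]

/-- If `⟨b δ_x, δ_y⟩ ⟨a δ_y, δ_z⟩ = 0` for all `y` then `⟨a b δ_x, δ_z⟩ = 0`. -/
theorem entry_mul_eq_zero (a b : Ell2 X →L[ℂ] Ell2 X) (x z : X)
    (h : ∀ y, entry b x y = 0 ∨ entry a y z = 0) : entry (a * b) x z = 0 := by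
  have h1 : entry (a * b) x z = inner ℂ (star a (delta z)) (b (delta x)) := by
    rw [ContinuousLinearMap.star_eq_adjoint, ContinuousLinearMap.adjoint_inner_left]
    rfl
  rw [h1, lp.inner_eq_tsum]
  refine (tsum_congr fun y => ?_).trans tsum_zero
  rw [← entry_eq, ← entry_eq, entry_star]
  rcases h y with h | h <;> simp [h]

end Facts

/-- The operators of finite propagation form a unital `*`-subalgebra of `B(ℓ₂(X))`. -/
def finitePropagationAlgebra (X : Type*) [MetricSpace X] :
    StarSubalgebra ℂ (Ell2 X →L[ℂ] Ell2 X) where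
  carrier := {a | FinitePropagation a}
  mul_mem' := by
    rintro a b ⟨r, hr, ha⟩ ⟨s, hs, hb⟩
    refine ⟨r + s, add_pos hr hs, fun x z hxz => entry_mul_eq_zero a b x z fun y => ?_⟩
    by_cases hxy : s < dist x y
    · exact Or.inl (hb x y hxy)
    · refine Or.inr (ha y z ?_)
      have := dist_triangle x y z
      linarith [not_lt.mp hxy]
  add_mem' := by
    rintro a b ⟨r, hr, ha⟩ ⟨s, hs, hb⟩
    refine ⟨max r s, lt_max_of_lt_left hr, fun x y hxy => ?_⟩
    rw [entry_add, ha x y ((le_max_left r s).trans_lt hxy),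
      hb x y ((le_max_right r s).trans_lt hxy), add_zero]
  algebraMap_mem' := by
    intro c
    refine ⟨1, one_pos, fun x y hxy => entry_algebraMap c ?_⟩
    rintro rfl
    rw [dist_self] at hxy
    linarith
  star_mem' := by
    rintro a ⟨r, hr, ha⟩
    refine ⟨r, hr, fun x y hxy => ?_⟩
    rw [entry_star, ha y x (by rwa [dist_comm]), star_zero]

/-- The uniform Roe algebra `C*_u(X)`: the operator norm closure in `B(ℓ₂(X))` of the algebra of
finite propagation operators. -/
def uniformRoeAlgebra (X : Type*) [MetricSpace X] :
    StarSubalgebra ℂ (Ell2 X →L[ℂ] Ell2 X) :=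
  (finitePropagationAlgebra X).topologicalClosure

/-- `X` is uniformly locally finite: `sup_x |B_r(x)| < ∞` for all `r > 0`. -/
def UniformlyLocallyFinite (X : Type*) [MetricSpace X] : Prop :=
  ∀ r : ℝ, 0 < r → ∃ N : ℕ, ∀ x : X, (Metric.closedBall x r).encard ≤ N

/-- `X` is sparse: it is the disjoint union of finite sets `X_n`, `n ∈ ℕ`, such that
`d(X_n, X_m) → ∞` as `n + m → ∞` with `n ≠ m` (pieces may be empty; the distance to the empty set
counts as infinite). -/
def Sparse (X : Type*) [MetricSpace X] : Prop :=
  ∃ P : ℕ → Set X, (∀ n, (P n).Finite) ∧ Pairwise (fun n m => Disjoint (P n) (P m)) ∧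
    (⋃ n, P n) = Set.univ ∧
    ∀ R : ℝ, ∃ N : ℕ, ∀ n m : ℕ, n ≠ m → N ≤ n + m → ∀ x ∈ P n, ∀ y ∈ P m, R ≤ dist x y

/-- `a` is a ghost: for every `ε > 0` there is a finite `A ⊆ X` with `|⟨a δ_x, δ_y⟩| < ε` for all
`x, y ∈ X \ A`. -/
def IsGhost {X : Type*} (a : Ell2 X →L[ℂ] Ell2 X) : Prop :=
  ∀ ε : ℝ, 0 < ε → ∃ A : Set X, A.Finite ∧ ∀ x y : X, x ∉ A → y ∉ A → ‖entry a x y‖ < ε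

/-- Every ghost projection in `C*_u(X)` is compact. -/
def YieldsOnlyCompactGhostProjections (X : Type*) [MetricSpace X] : Prop :=
  ∀ p ∈ uniformRoeAlgebra X, IsStarProjection p → IsGhost p → IsCompactOperator p

/-- A minimal projection of a complex `*`-algebra `A`: a nonzero projection `p` with
`p A p = ℂ p`. -/
def IsMinimalProjection {A : Type*} [Ring A] [StarRing A] [Algebra ℂ A] (p : A) : Prop :=
  IsStarProjection p ∧ p ≠ 0 ∧ ∀ a : A, ∃ c : ℂ, p * a * p = c • p

/-- `Φ` is rank preserving: it sends minimal projections to minimal projections. -/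
def RankPreserving {X Y : Type*} [MetricSpace X] [MetricSpace Y]
    (Φ : uniformRoeAlgebra X →⋆ₙₐ[ℂ] uniformRoeAlgebra Y) : Prop :=
  ∀ p : uniformRoeAlgebra X, IsMinimalProjection p → IsMinimalProjection (Φ p)

/-- `f` is coarse: `sup {d(f x, f x') | d(x, x') ≤ r} < ∞` for all `r > 0`. -/
def IsCoarse {X Y : Type*} [MetricSpace X] [MetricSpace Y] (f : X → Y) : Prop :=
  ∀ r : ℝ, 0 < r → ∃ s : ℝ, ∀ x x' : X, dist x x' ≤ r → dist (f x) (f x') ≤ s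

/-- `f` is uniformly finite-to-one: `sup_y |f⁻¹({y})| < ∞`. -/
def UniformlyFiniteToOne {X Y : Type*} (f : X → Y) : Prop :=
  ∃ k : ℕ, ∀ y : Y, (f ⁻¹' {y}).encard ≤ k

end UniformRoe

end

noncomputable section

namespace UniformRoe

open InnerProductSpace Filter Topology ContinuousLinearMap

/-! ### Coordinates, isometries and their adjoints on ℓ₂. -/

section Operators

variable {X Y ι : Type*}

/-! Rank preservation yields an isometry `u` with Φ(a)u = ua, such that `u δ_x` spans the range of
Φ(e_xx), where e_xx is the projection onto ℂδ_x (`RankPreserving.exists_isometry`). The map `f`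
sends x to a point where `u δ_x` has a large coefficient.

Φ need not be strongly continuous, so Φ(a) may differ from uau*. An uncountable almost disjoint
family repairs this: on the complement of the range of `u` the corresponding projections act
orthogonally, and ℓ₂(Y) is separable, so some of them act as zero. Hence Φ(ap) = uapu* for p the
projection onto a suitable subsequence of any given sequence of points
(`exists_subsequence_rangeProjection`, `map_mul_eq_of_annihilates`).

Large coefficients exist uniformly in x (`exists_coefficient_bound`): otherwise some vectors `u δ_x`
are close to unit vectors with small coefficients and finite supports drifting apart, and the
projection onto the span of the latter is a noncompact ghost on a sparse subspace. Bessel's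
inequality then bounds the fibres of `f`, and applying Φ to a partial translation shows that `f` is
coarse (`isCoarse_of_coefficient_bound`). -/

theorem inner_delta_right (x : X) (v : Ell2 X) : inner ℂ v (delta x) = star (v x) := by
  rw [← inner_delta x v]
  exact (inner_conj_symm _ _).symm

theorem delta_apply_self (x : X) : (delta x : Ell2 X) x = 1 := by
  classical
  simp [delta, lp.single_apply]

theorem delta_apply [DecidableEq X] (x y : X) : (delta x : Ell2 X) y = if y = x then 1 else 0 := by
  split_ifs with h
  · rw [h, delta_apply_self]
  · exact delta_apply_ne h

theorem orthonormal_delta : Orthonormal ℂ (delta : X → Ell2 X) := by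
  classical
  rw [orthonormal_iff_ite]
  intro x y
  rw [inner_delta, delta_apply]

theorem hasSum_smul_delta (v : Ell2 X) : HasSum (fun x => v x • (delta x : Ell2 X)) v := by
  classical
  have h := lp.hasSum_single (p := 2) (by simp) v
  refine h.congr_fun ?_
  intro x
  ext y
  by_cases hxy : y = x
  · subst hxy; simp [delta]
  · simp [delta, hxy, lp.single_apply]

/-- The isometry from `ℓ₂(ι)` which sends the canonical basis to a given orthonormal family. -/
def isometryOfOrthonormal {H : Type*} [NormedAddCommGroup H] [InnerProductSpace ℂ H]
    [CompleteSpace H] {v : ι → H} (hv : Orthonormal ℂ v) : Ell2 ι →ₗᵢ[ℂ] H :=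
  hv.orthogonalFamily.linearIsometry

theorem isometryOfOrthonormal_delta {H : Type*} [NormedAddCommGroup H] [InnerProductSpace ℂ H]
    [CompleteSpace H] {v : ι → H} (hv : Orthonormal ℂ v) (i : ι) :
    isometryOfOrthonormal hv (delta i) = v i := by
  classical
  unfold isometryOfOrthonormal delta
  erw [hv.orthogonalFamily.linearIsometry_apply_single]
  simp

/-- The adjoint of an isometry. -/
abbrev coisometry {H K : Type*} [NormedAddCommGroup H] [InnerProductSpace ℂ H] [CompleteSpace H]
    [NormedAddCommGroup K] [InnerProductSpace ℂ K] [CompleteSpace K] (u : H →ₗᵢ[ℂ] K) :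
    K →L[ℂ] H :=
  adjoint u.toContinuousLinearMap

theorem coisometry_apply_isometry {H K : Type*} [NormedAddCommGroup H] [InnerProductSpace ℂ H]
    [CompleteSpace H] [NormedAddCommGroup K] [InnerProductSpace ℂ K] [CompleteSpace K]
    (u : H →ₗᵢ[ℂ] K) (v : H) : coisometry u (u v) = v := by
  refine ext_inner_left ℂ fun w => ?_
  rw [coisometry, adjoint_inner_right]
  exact u.inner_map_map w v

theorem coisometry_apply {H : Type*} [NormedAddCommGroup H] [InnerProductSpace ℂ H]
    [CompleteSpace H] (u : Ell2 ι →ₗᵢ[ℂ] H) (w : H) (i : ι) :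
    coisometry u w i = inner ℂ (u (delta i)) w := by
  rw [← inner_delta, coisometry, adjoint_inner_right]
  rfl

theorem orthonormal_isometry_delta {H : Type*} [NormedAddCommGroup H] [InnerProductSpace ℂ H]
    (u : Ell2 ι →ₗᵢ[ℂ] H) : Orthonormal ℂ fun i => u (delta i) :=
  orthonormal_delta.comp_linearIsometry u

/-- The sum is taken vector by vector: its terms have norm one as operators, so for infinite `ι`
there is no norm convergence. -/
theorem hasSum_isometry_coisometry {H K : Type*} [NormedAddCommGroup H] [InnerProductSpace ℂ H]
    [CompleteSpace H] [NormedAddCommGroup K] [InnerProductSpace ℂ K] [CompleteSpace K]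
    (u : Ell2 ι →ₗᵢ[ℂ] H) (u' : Ell2 ι →ₗᵢ[ℂ] K) (w : K) :
    HasSum (fun i => rankOne ℂ (u (delta i)) (u' (delta i)) w) (u (coisometry u' w)) := by
  have h := (hasSum_smul_delta (coisometry u' w)).mapL u.toContinuousLinearMap
  refine h.congr_fun ?_
  intro i
  simp [coisometry_apply]

theorem hasSum_inner_isometry_coisometry {H K : Type*} [NormedAddCommGroup H]
    [InnerProductSpace ℂ H] [CompleteSpace H] [NormedAddCommGroup K] [InnerProductSpace ℂ K]
    [CompleteSpace K] (u : Ell2 ι →ₗᵢ[ℂ] H) (u' : Ell2 ι →ₗᵢ[ℂ] K) (v : H) (w : K) :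
    HasSum (fun i => inner ℂ v (u (delta i)) * inner ℂ (u' (delta i)) w)
      (inner ℂ v (u (coisometry u' w))) := by
  have h := (hasSum_isometry_coisometry u u' w).mapL (innerSL ℂ v)
  refine h.congr_fun ?_
  intro i
  simp [mul_comm]

theorem entry_isometry_coisometry_eq_zero (u u' : Ell2 ι →ₗᵢ[ℂ] Ell2 X) (x y : X)
    (h : ∀ i, u (delta i) y = 0 ∨ u' (delta i) x = 0) :
    entry (u.toContinuousLinearMap ∘L coisometry u') x y = 0 := by
  have h1 := hasSum_inner_isometry_coisometry u u' (delta y) (delta x)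
  refine h1.unique ?_
  convert hasSum_zero with i
  rw [inner_delta, inner_delta_right]
  rcases h i with h | h <;> simp [h]

theorem norm_entry_le (a : Ell2 X →L[ℂ] Ell2 X) (x y : X) : ‖entry a x y‖ ≤ ‖a‖ := by
  refine (norm_inner_le_norm _ _).trans ?_
  have h := a.le_opNorm (delta x)
  have h1 := orthonormal_delta.norm_eq_one x
  have h2 := orthonormal_delta.norm_eq_one y
  rw [h1] at h
  rw [h2]
  linarith

end Operators

/-! ### Elements of the uniform Roe algebra. -/

section RoeAlgebra

variable {X Y : Type*} [MetricSpace X] [MetricSpace Y]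

theorem mem_uniformRoeAlgebra_iff {a : Ell2 X →L[ℂ] Ell2 X} :
    a ∈ uniformRoeAlgebra X ↔ a ∈ closure {a : Ell2 X →L[ℂ] Ell2 X | FinitePropagation a} := by
  rw [← SetLike.mem_coe, uniformRoeAlgebra, StarSubalgebra.topologicalClosure_coe]
  rfl

theorem isClosed_uniformRoeAlgebra :
    IsClosed (uniformRoeAlgebra X : Set (Ell2 X →L[ℂ] Ell2 X)) := by
  rw [uniformRoeAlgebra, StarSubalgebra.topologicalClosure_coe]
  exact isClosed_closure

theorem FinitePropagation.mem_uniformRoeAlgebra {a : Ell2 X →L[ℂ] Ell2 X}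
    (h : FinitePropagation a) : a ∈ uniformRoeAlgebra X :=
  StarSubalgebra.le_topologicalClosure _ h

theorem hasSum_mem_uniformRoeAlgebra {ι : Type*} {F : ι → Ell2 X →L[ℂ] Ell2 X}
    {a : Ell2 X →L[ℂ] Ell2 X} (h : HasSum F a) (hF : ∀ i, F i ∈ uniformRoeAlgebra X) :
    a ∈ uniformRoeAlgebra X :=
  isClosed_uniformRoeAlgebra.mem_of_tendsto h
    (Eventually.of_forall fun _ => sum_mem fun i _ => hF i)

/-- The coefficients of an element of the uniform Roe algebra vanish uniformly at infinite
distance from the diagonal. -/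
theorem exists_norm_entry_lt {a : Ell2 X →L[ℂ] Ell2 X} (ha : a ∈ uniformRoeAlgebra X) {ε : ℝ}
    (hε : 0 < ε) : ∃ s : ℝ, ∀ x y : X, s < dist x y → ‖entry a x y‖ < ε := by
  obtain ⟨b, ⟨s, _, hb⟩, hab⟩ := Metric.mem_closure_iff.1 (mem_uniformRoeAlgebra_iff.1 ha) ε hε
  refine ⟨s, fun x y hxy => ?_⟩
  have h : entry a x y = entry (a - b) x y + entry b x y := by
    rw [← entry_add, sub_add_cancel]
  rw [h, hb x y hxy, add_zero]
  exact (norm_entry_le _ _ _).trans_lt (by rwa [← dist_eq_norm])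

/-- Matrix units have finite propagation; norm continuity in each argument separately reaches
arbitrary vectors. -/
theorem rankOne_mem_uniformRoeAlgebra (v w : Ell2 X) :
    (rankOne ℂ v w : Ell2 X →L[ℂ] Ell2 X) ∈ uniformRoeAlgebra X := by
  have h1 (x y : X) : (rankOne ℂ (delta x) (delta y) : Ell2 X →L[ℂ] Ell2 X) ∈
      uniformRoeAlgebra X := by
    refine FinitePropagation.mem_uniformRoeAlgebra
      ⟨dist x y + 1, by positivity, fun p q hpq => ?_⟩
    rw [entry_eq, rankOne_apply, inner_delta]
    by_cases hp : y = p
    · by_cases hq : q = x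
      · subst hp hq
        rw [dist_comm] at hpq
        linarith
      · simp [delta_apply_ne hq]
    · simp [delta_apply_ne hp]
  have h2 (x : X) : (rankOne ℂ (delta x) w : Ell2 X →L[ℂ] Ell2 X) ∈ uniformRoeAlgebra X := by
    refine hasSum_mem_uniformRoeAlgebra
      ((hasSum_smul_delta w).mapL (rankOne ℂ (delta x) : Ell2 X →L⋆[ℂ] Ell2 X →L[ℂ] Ell2 X)) ?_
    intro y
    rw [map_smulₛₗ]
    exact SMulMemClass.smul_mem _ (h1 x y)
  refine hasSum_mem_uniformRoeAlgebra ((hasSum_smul_delta v).mapL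
    ((rankOne ℂ : Ell2 X →L[ℂ] Ell2 X →L⋆[ℂ] Ell2 X →L[ℂ] Ell2 X).flip w)) ?_
  intro x
  rw [map_smul]
  exact SMulMemClass.smul_mem _ (h2 x)

/-- The compression of an operator on `ℓ₂(Y)` to `ℓ₂` of a subspace. -/
theorem compression_mem_uniformRoeAlgebra (S : Set Y) {a : Ell2 Y →L[ℂ] Ell2 Y}
    (ha : a ∈ uniformRoeAlgebra Y) (ι : Ell2 S →ₗᵢ[ℂ] Ell2 Y)
    (hι : ∀ s : S, ι (delta s) = delta (s : Y)) :
    coisometry ι ∘L a ∘L ι.toContinuousLinearMap ∈ uniformRoeAlgebra S := by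
  rw [mem_uniformRoeAlgebra_iff] at ha ⊢
  refine map_mem_closure (f := fun a => coisometry ι ∘L a ∘L ι.toContinuousLinearMap)
    (by fun_prop) ha ?_
  rintro b ⟨r, hr, hb⟩
  refine ⟨r, hr, fun x y hxy => ?_⟩
  have := hb x y hxy
  rw [entry] at this ⊢
  rw [← hι, ← hι] at this
  rw [← this]
  simp [coisometry, adjoint_inner_right]

end RoeAlgebra

/-! ### Minimal projections and the intertwining isometry. -/

section Intertwining

variable {X Y : Type*} [MetricSpace X] [MetricSpace Y]

/-- The rank one operator `|v⟩⟨w|` as an element of the uniform Roe algebra. -/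
def rankOneRoe (v w : Ell2 X) : uniformRoeAlgebra X :=
  ⟨rankOne ℂ v w, rankOne_mem_uniformRoeAlgebra v w⟩

theorem rankOneRoe_mul_rankOneRoe (v w v' w' : Ell2 X) :
    rankOneRoe v w * rankOneRoe v' w' = (inner ℂ w v' : ℂ) • rankOneRoe v w' := by
  refine Subtype.ext (ContinuousLinearMap.ext fun z => ?_)
  change inner ℂ w ((inner ℂ w' z : ℂ) • v') • v = (inner ℂ w v' : ℂ) • ((inner ℂ w' z : ℂ) • v)
  rw [inner_smul_right, smul_smul, mul_comm]

theorem star_rankOneRoe (v w : Ell2 X) : star (rankOneRoe v w) = rankOneRoe w v :=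
  Subtype.ext (adjoint_rankOne v w)

theorem mul_rankOneRoe (a : uniformRoeAlgebra X) (v w : Ell2 X) :
    a * rankOneRoe v w = rankOneRoe ((a : Ell2 X →L[ℂ] Ell2 X) v) w := by
  refine Subtype.ext (ContinuousLinearMap.ext fun z => ?_)
  change (a : Ell2 X →L[ℂ] Ell2 X) ((inner ℂ w z : ℂ) • v) = (inner ℂ w z : ℂ) • _
  rw [map_smul]

theorem rankOneRoe_add (v v' w : Ell2 X) :
    rankOneRoe (v + v') w = rankOneRoe v w + rankOneRoe v' w :=
  Subtype.ext (by simp [rankOneRoe])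

theorem rankOneRoe_smul (c : ℂ) (v w : Ell2 X) :
    rankOneRoe (c • v) w = c • rankOneRoe v w :=
  Subtype.ext (by simp [rankOneRoe])

theorem isMinimalProjection_rankOneRoe {v : Ell2 X} (hv : ‖v‖ = 1) :
    IsMinimalProjection (rankOneRoe v v) := by
  have hvv : inner ℂ v v = (1 : ℂ) := by simp [hv]
  refine ⟨⟨?_, star_rankOneRoe v v⟩, ?_, fun a => ⟨inner ℂ v ((a : Ell2 X →L[ℂ] Ell2 X) v), ?_⟩⟩
  · rw [IsIdempotentElem, rankOneRoe_mul_rankOneRoe, hvv, one_smul]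
  · intro h
    have h1 : rankOne ℂ v v = 0 := congrArg Subtype.val h
    rw [rankOne_eq_zero, or_self] at h1
    simp [h1] at hv
  · rw [mul_assoc, mul_rankOneRoe, rankOneRoe_mul_rankOneRoe]

/-- A minimal projection of the uniform Roe algebra has rank one. -/
theorem IsMinimalProjection.eq_zero_of_inner_eq_zero {q : uniformRoeAlgebra Y}
    (hq : IsMinimalProjection q) {ξ v : Ell2 Y} (hξ0 : ξ ≠ 0)
    (hξ : (q : Ell2 Y →L[ℂ] Ell2 Y) ξ = ξ) (hv : inner ℂ ξ v = (0 : ℂ)) :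
    (q : Ell2 Y →L[ℂ] Ell2 Y) v = 0 := by
  obtain ⟨⟨-, hsa⟩, -, h⟩ := hq
  -- Since qξ = ξ, compressing |ξ⟩⟨ξ| by q returns |ξ⟩⟨ξ|; minimality makes it a multiple of q.
  obtain ⟨c, hc⟩ := h (rankOneRoe ξ ξ)
  have hq' : ∀ w z, inner ℂ ((q : Ell2 Y →L[ℂ] Ell2 Y) w) z =
      (inner ℂ w ((q : Ell2 Y →L[ℂ] Ell2 Y) z) : ℂ) := by
    intro w z
    have h1 : adjoint (q : Ell2 Y →L[ℂ] Ell2 Y) = q := congrArg Subtype.val hsa.star_eq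
    rw [← adjoint_inner_right, h1]
  have happ : ∀ z, (inner ℂ ξ z : ℂ) • ξ = c • (q : Ell2 Y →L[ℂ] Ell2 Y) z := by
    intro z
    have h1 := congrArg (fun a : uniformRoeAlgebra Y => (a : Ell2 Y →L[ℂ] Ell2 Y) z) hc
    change (q : Ell2 Y →L[ℂ] Ell2 Y) ((inner ℂ ξ ((q : Ell2 Y →L[ℂ] Ell2 Y) z) : ℂ) • ξ) =
      c • (q : Ell2 Y →L[ℂ] Ell2 Y) z at h1
    rwa [map_smul, ← hq', hξ] at h1
  have hc0 : c ≠ 0 := by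
    rintro rfl
    have := happ ξ
    rw [zero_smul, smul_eq_zero, inner_self_eq_zero] at this
    tauto
  have := happ v
  rw [hv, zero_smul] at this
  exact (smul_eq_zero.1 this.symm).resolve_left hc0

/-- A rank preserving embedding of uniform Roe algebras is spatially implemented on a reducing
subspace. -/
theorem RankPreserving.exists_isometry [Nonempty X]
    {Φ : uniformRoeAlgebra X →⋆ₙₐ[ℂ] uniformRoeAlgebra Y} (hΦ : RankPreserving Φ) :
    ∃ u : Ell2 X →ₗᵢ[ℂ] Ell2 Y,
      (∀ (a : uniformRoeAlgebra X) (v : Ell2 X),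
        (Φ a : Ell2 Y →L[ℂ] Ell2 Y) (u v) = u ((a : Ell2 X →L[ℂ] Ell2 X) v)) ∧
      ∀ (x : X) (v : Ell2 Y), inner ℂ (u (delta x)) v = (0 : ℂ) →
        (Φ (rankOneRoe (delta x) (delta x)) : Ell2 Y →L[ℂ] Ell2 Y) v = 0 := by
  obtain ⟨o⟩ := ‹Nonempty X›
  have hone : ∀ x : X, ‖(delta x : Ell2 X)‖ = 1 := orthonormal_delta.norm_eq_one
  have hin : ∀ x : X, inner ℂ (delta x : Ell2 X) (delta x) = (1 : ℂ) := fun x => by simp [hone]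
  have hmin x := hΦ _ (isMinimalProjection_rankOneRoe (hone x))
  set q : uniformRoeAlgebra Y := Φ (rankOneRoe (delta o) (delta o)) with hq
  obtain ⟨ξ, hξ, hqξ⟩ : ∃ ξ : Ell2 Y, ‖ξ‖ = 1 ∧ (q : Ell2 Y →L[ℂ] Ell2 Y) ξ = ξ := by
    obtain ⟨⟨hid, -⟩, hne, -⟩ := hmin o
    obtain ⟨w, hw⟩ : ∃ w, (q : Ell2 Y →L[ℂ] Ell2 Y) w ≠ 0 := by
      by_contra! h
      exact hne (Subtype.ext (ContinuousLinearMap.ext h))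
    refine ⟨((‖(q : Ell2 Y →L[ℂ] Ell2 Y) w‖ : ℂ)⁻¹) • (q : Ell2 Y →L[ℂ] Ell2 Y) w, ?_, ?_⟩
    · rw [norm_smul, norm_inv, Complex.norm_real, norm_norm,
        inv_mul_cancel₀ (norm_ne_zero_iff.2 hw)]
    · rw [map_smul]
      congr 1
      exact congrArg (fun a : uniformRoeAlgebra Y => (a : Ell2 Y →L[ℂ] Ell2 Y) w) hid
  -- Inner products are preserved because |v⟩⟨δ_o|* |w⟩⟨δ_o| = ⟨v, w⟩ |δ_o⟩⟨δ_o| and qξ = ξ;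
  -- intertwining holds because a|v⟩⟨δ_o| = |av⟩⟨δ_o|.
  let T : Ell2 X →ₗ[ℂ] Ell2 Y :=
    { toFun := fun v => (Φ (rankOneRoe v (delta o)) : Ell2 Y →L[ℂ] Ell2 Y) ξ
      map_add' := fun v w => by rw [rankOneRoe_add, map_add]; rfl
      map_smul' := fun c v => by rw [rankOneRoe_smul, map_smul]; rfl }
  have hT : ∀ v w, inner ℂ (T v) (T w) = (inner ℂ v w : ℂ) := by
    intro v w
    have h1 : inner ℂ (T v) (T w) = inner ℂ ξ
        (((star (Φ (rankOneRoe v (delta o))) * Φ (rankOneRoe w (delta o)) :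
          uniformRoeAlgebra Y) : Ell2 Y →L[ℂ] Ell2 Y) ξ) :=
      (adjoint_inner_right _ _ _).symm
    rw [h1, ← map_star, ← map_mul, star_rankOneRoe, rankOneRoe_mul_rankOneRoe, map_smul]
    change inner ℂ ξ ((inner ℂ v w : ℂ) • (q : Ell2 Y →L[ℂ] Ell2 Y) ξ) = _
    rw [hqξ, inner_smul_right, inner_self_eq_norm_sq_to_K, hξ]
    simp
  have hmul : ∀ (a : uniformRoeAlgebra X) (v : Ell2 X),
      (Φ a : Ell2 Y →L[ℂ] Ell2 Y) (T v) = T ((a : Ell2 X →L[ℂ] Ell2 X) v) := by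
    intro a v
    change _ = (Φ (rankOneRoe _ (delta o)) : Ell2 Y →L[ℂ] Ell2 Y) ξ
    rw [← mul_rankOneRoe, map_mul]
    rfl
  refine ⟨T.isometryOfInner hT, hmul, fun x v hv => ?_⟩
  refine (hmin x).eq_zero_of_inner_eq_zero ?_ ?_ hv
  · rw [← norm_ne_zero_iff, LinearIsometry.norm_map, hone]
    exact one_ne_zero
  · refine (hmul _ _).trans ?_
    change T ((inner ℂ (delta x : Ell2 X) (delta x) : ℂ) • delta x) = _
    rw [hin, one_smul]
    rfl

end Intertwining

/-! ### An almost disjoint family of subsets of ℕ indexed by 2^ℕ. -/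

section AlmostDisjoint

/-- The natural numbers whose binary expansions are `1` followed by an initial segment of `t`. -/
def binaryPrefix (t : ℕ → Bool) : ℕ → ℕ
  | 0 => 1
  | n + 1 => 2 * binaryPrefix t n + (t n).toNat

theorem binaryPrefix_mem (t : ℕ → Bool) (n : ℕ) :
    2 ^ n ≤ binaryPrefix t n ∧ binaryPrefix t n < 2 ^ (n + 1) := by
  induction n with
  | zero => simp [binaryPrefix]
  | succ n ih =>
    have := (t n).toNat_le
    rw [binaryPrefix, pow_succ 2 (n + 1), pow_succ 2 n]
    rw [pow_succ] at ih
    omega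

theorem strictMono_binaryPrefix (t : ℕ → Bool) : StrictMono (binaryPrefix t) :=
  strictMono_nat_of_lt_succ fun n =>
    (binaryPrefix_mem t n).2.trans_le (binaryPrefix_mem t (n + 1)).1

theorem index_eq_of_binaryPrefix_eq {s t : ℕ → Bool} {m n : ℕ}
    (h : binaryPrefix s m = binaryPrefix t n) : m = n := by
  have h1 := binaryPrefix_mem s m
  have h2 := binaryPrefix_mem t n
  rw [h] at h1
  have h3 := (Nat.pow_lt_pow_iff_right one_lt_two).1 (h1.1.trans_lt h2.2)
  have h4 := (Nat.pow_lt_pow_iff_right one_lt_two).1 (h2.1.trans_lt h1.2)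
  omega

theorem eq_of_binaryPrefix_eq {s t : ℕ → Bool} {n : ℕ}
    (h : binaryPrefix s n = binaryPrefix t n) : ∀ k < n, s k = t k := by
  induction n with
  | zero => simp
  | succ n ih =>
    rw [binaryPrefix, binaryPrefix] at h
    have hs := (s n).toNat_le
    have ht := (t n).toNat_le
    intro k hk
    rcases Nat.lt_succ_iff_lt_or_eq.1 hk with hk | rfl
    · exact ih (by omega) k hk
    · have heq : (s k).toNat = (t k).toNat := by omega
      revert heq
      cases s k <;> cases t k <;> simp

/-- A prefix determines its length and its digits, so two branches of the binary tree share no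
vertex beyond the place where they split. -/
theorem finite_range_binaryPrefix_inter {s t : ℕ → Bool} (hst : s ≠ t) :
    (Set.range (binaryPrefix s) ∩ Set.range (binaryPrefix t)).Finite := by
  obtain ⟨k, hk⟩ := Function.ne_iff.1 hst
  refine ((Set.finite_Iic k).image (binaryPrefix s)).subset ?_
  rintro _ ⟨⟨m, rfl⟩, n, hn⟩
  obtain rfl := index_eq_of_binaryPrefix_eq hn
  refine ⟨n, ?_, rfl⟩
  by_contra hkn
  exact hk (eq_of_binaryPrefix_eq hn.symm k (not_le.1 hkn))

end AlmostDisjoint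

/-! ### Partial translations and coordinate projections. -/

section PartialTranslations

variable {X ι : Type*}

/-- The isometry `δ_i ↦ δ_{g i}` induced by an injective map. -/
def deltaIsometry {g : ι → X} (hg : g.Injective) : Ell2 ι →ₗᵢ[ℂ] Ell2 X :=
  isometryOfOrthonormal (orthonormal_delta.comp g hg)

theorem deltaIsometry_delta {g : ι → X} (hg : g.Injective) (i : ι) :
    deltaIsometry hg (delta i) = delta (g i) :=
  isometryOfOrthonormal_delta _ i

theorem coisometry_deltaIsometry_apply {g : ι → X} (hg : g.Injective) (v : Ell2 X) (i : ι) :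
    coisometry (deltaIsometry hg) v i = v (g i) := by
  rw [coisometry_apply, deltaIsometry_delta, inner_delta]

theorem deltaIsometry_apply {g : ι → X} (hg : g.Injective) (v : Ell2 ι) (i : ι) :
    deltaIsometry hg v (g i) = v i := by
  rw [← inner_delta, ← deltaIsometry_delta hg, LinearIsometry.inner_map_map, inner_delta]

theorem deltaIsometry_apply_of_notMem {g : ι → X} (hg : g.Injective) (v : Ell2 ι) {x : X}
    (hx : x ∉ Set.range g) : deltaIsometry hg v x = 0 := by
  have h := ((hasSum_smul_delta v).mapL (deltaIsometry hg).toContinuousLinearMap).mapL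
    (innerSL ℂ (delta x))
  rw [← inner_delta]
  refine h.unique ?_
  convert hasSum_zero with i
  have hne : x ≠ g i := fun h => hx ⟨i, h.symm⟩
  simp [deltaIsometry_delta, inner_delta, delta_apply_ne hne]

theorem deltaIsometry_coisometry_apply {g : ι → X} (hg : g.Injective) (v : Ell2 X) (x : X) :
    deltaIsometry hg (coisometry (deltaIsometry hg) v) x = (Set.range g).indicator v x := by
  by_cases hx : x ∈ Set.range g
  · rw [Set.indicator_of_mem hx]
    obtain ⟨i, rfl⟩ := hx
    rw [deltaIsometry_apply, coisometry_deltaIsometry_apply]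
  · rw [Set.indicator_of_notMem hx, deltaIsometry_apply_of_notMem hg _ hx]

/-- By Bessel, each `δ_y` meets only countably many members, and every member meets some `δ_y`. -/
theorem countable_of_orthonormal {Y : Type*} [Countable Y] {e : ι → Ell2 Y}
    (he : Orthonormal ℂ e) : Countable ι := by
  rw [← Set.countable_univ_iff]
  refine (Set.countable_iUnion fun y : Y =>
    (he.inner_products_summable (delta y)).countable_support).mono fun i _ => ?_
  by_contra h
  rw [Set.mem_iUnion, not_exists] at h
  refine he.ne_zero i ?_
  ext y
  simpa [inner_delta_right] using h y

variable [MetricSpace X]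

theorem partialTranslation_mem {g g' : ι → X} (hg : g.Injective) (hg' : g'.Injective) {r : ℝ}
    (hr : 0 < r) (h : ∀ i, dist (g i) (g' i) ≤ r) :
    (deltaIsometry hg').toContinuousLinearMap ∘L coisometry (deltaIsometry hg) ∈
      uniformRoeAlgebra X := by
  refine FinitePropagation.mem_uniformRoeAlgebra ⟨r, hr, fun x y hxy => ?_⟩
  refine entry_isometry_coisometry_eq_zero _ _ _ _ fun i => ?_
  rw [deltaIsometry_delta, deltaIsometry_delta]
  by_contra! hne
  have h1 : y = g' i := by
    by_contra h1
    exact hne.1 (delta_apply_ne h1)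
  have h2 : x = g i := by
    by_contra h2
    exact hne.2 (delta_apply_ne h2)
  rw [h1, h2] at hxy
  exact (h i).not_gt hxy

/-- The partial translation `δ_{g i} ↦ δ_{g' i}`. -/
def partialTranslation {g g' : ι → X} (hg : g.Injective) (hg' : g'.Injective) {r : ℝ}
    (hr : 0 < r) (h : ∀ i, dist (g i) (g' i) ≤ r) : uniformRoeAlgebra X :=
  ⟨_, partialTranslation_mem hg hg' hr h⟩

/-- The projection onto `ℓ₂` of the range of an injective map. -/
def rangeProjection {g : ι → X} (hg : g.Injective) : uniformRoeAlgebra X :=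
  partialTranslation hg hg one_pos fun i => by simp

theorem partialTranslation_mul_rangeProjection {g g' : ι → X} (hg : g.Injective)
    (hg' : g'.Injective) {r : ℝ} (hr : 0 < r) (h : ∀ i, dist (g i) (g' i) ≤ r) :
    partialTranslation hg hg' hr h * rangeProjection hg = partialTranslation hg hg' hr h := by
  refine Subtype.ext (ContinuousLinearMap.ext fun z => ?_)
  change deltaIsometry hg' (coisometry (deltaIsometry hg) (deltaIsometry hg
    (coisometry (deltaIsometry hg) z))) = deltaIsometry hg' (coisometry (deltaIsometry hg) z)
  rw [coisometry_apply_isometry]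

theorem star_rangeProjection {g : ι → X} (hg : g.Injective) :
    star (rangeProjection hg) = rangeProjection hg := by
  refine Subtype.ext ?_
  change adjoint (_ ∘L adjoint _) = _ ∘L adjoint _
  rw [adjoint_comp, adjoint_adjoint]

/-- A finite intersection gives a finite sum, so Φ of the product can be computed without any
continuity in the strong topology. -/
theorem rangeProjection_mul_rangeProjection {g h : ι → X} (hg : g.Injective) (hh : h.Injective)
    (hfin : (Set.range g ∩ Set.range h).Finite) :
    rangeProjection hg * rangeProjection hh =
      ∑ x ∈ hfin.toFinset, rankOneRoe (delta x) (delta x) := by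
  classical
  refine Subtype.ext (ContinuousLinearMap.ext fun z => ?_)
  ext x
  have h1 : (((rangeProjection hg * rangeProjection hh : uniformRoeAlgebra X) :
      Ell2 X →L[ℂ] Ell2 X) z) x = (Set.range g ∩ Set.range h).indicator z x := by
    refine (deltaIsometry_coisometry_apply hg _ x).trans ?_
    rw [← Set.indicator_indicator]
    by_cases hx : x ∈ Set.range g
    · rw [Set.indicator_of_mem hx, Set.indicator_of_mem hx]
      exact deltaIsometry_coisometry_apply hh z x
    · rw [Set.indicator_of_notMem hx, Set.indicator_of_notMem hx]
  rw [h1, AddSubmonoidClass.coe_finsetSum, sum_apply, ← inner_delta, inner_sum]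
  simp [rankOneRoe, inner_smul_right, inner_delta, delta_apply, Set.indicator_apply]

end PartialTranslations

/-! ### Spatial implementation along a subsequence. -/

section Subsequence

variable {X Y : Type*} [MetricSpace X] [MetricSpace Y]

/-- Along a suitable subsequence of a sequence of distinct points of `X`, a rank preserving
embedding is spatially implemented. -/
theorem exists_subsequence_rangeProjection [Countable Y]
    (Φ : uniformRoeAlgebra X →⋆ₙₐ[ℂ] uniformRoeAlgebra Y) (u : Ell2 X →ₗᵢ[ℂ] Ell2 Y)
    (hu : ∀ (x : X) (v : Ell2 Y), inner ℂ (u (delta x)) v = (0 : ℂ) →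
      (Φ (rankOneRoe (delta x) (delta x)) : Ell2 Y →L[ℂ] Ell2 Y) v = 0)
    {g : ℕ → X} (hg : g.Injective) :
    ∃ (φ : ℕ → ℕ) (hφ : StrictMono φ), ∀ v : Ell2 Y, (∀ x, inner ℂ (u (delta x)) v = (0 : ℂ)) →
      (Φ (rangeProjection (hg.comp hφ.injective)) : Ell2 Y →L[ℂ] Ell2 Y) v = 0 := by
  by_contra! hcon
  choose v hv0 hv using fun t : ℕ → Bool => hcon _ (strictMono_binaryPrefix t)
  set p := fun t : ℕ → Bool =>
    rangeProjection (hg.comp (strictMono_binaryPrefix t).injective) with hp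
  set w := fun t => (Φ (p t) : Ell2 Y →L[ℂ] Ell2 Y) (v t) with hw
  -- The product of two of the projections is a finite sum of e_xx, and each Φ(e_xx) kills `v t`,
  -- which is orthogonal to the range of `u`.
  have horth : ∀ s t, s ≠ t → inner ℂ (w s) (w t) = (0 : ℂ) := by
    intro s t hst
    have h1 : inner ℂ (w s) (w t) = inner ℂ (v s)
        (((star (Φ (p s)) * Φ (p t) : uniformRoeAlgebra Y) : Ell2 Y →L[ℂ] Ell2 Y) (v t)) :=
      (adjoint_inner_right _ _ _).symm
    have hfin : (Set.range (g ∘ binaryPrefix s) ∩ Set.range (g ∘ binaryPrefix t)).Finite := by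
      rw [Set.range_comp, Set.range_comp, ← Set.image_inter hg]
      exact (finite_range_binaryPrefix_inter hst).image g
    rw [h1, ← map_star, ← map_mul, star_rangeProjection,
      rangeProjection_mul_rangeProjection _ _ hfin, map_sum, AddSubmonoidClass.coe_finsetSum,
      sum_apply, Finset.sum_eq_zero, inner_zero_right]
    exact fun x _ => hu x _ (hv0 t x)
  have horth' : Orthonormal ℂ fun t => ((‖w t‖ : ℂ)⁻¹) • w t := by
    refine ⟨fun t => ?_, fun s t hst => ?_⟩
    · rw [norm_smul, norm_inv, Complex.norm_real, norm_norm,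
        inv_mul_cancel₀ (norm_ne_zero_iff.2 (hv t))]
    · simp only [inner_smul_left, inner_smul_right, horth s t hst, mul_zero]
  have : Countable (ℕ → Bool) := countable_of_orthonormal horth'
  obtain ⟨F, hF⟩ := exists_surjective_nat (ℕ → Bool)
  obtain ⟨n, hn⟩ := hF fun k => !(F k k)
  simpa using congrFun hn n

/-- If `Φ p` annihilates the complement of the range of `u`, then `Φ (a p) = u a p u*`. -/
theorem map_mul_eq_of_annihilates {Φ : uniformRoeAlgebra X →⋆ₙₐ[ℂ] uniformRoeAlgebra Y}
    {u : Ell2 X →ₗᵢ[ℂ] Ell2 Y}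
    (hΦ : ∀ (a : uniformRoeAlgebra X) (v : Ell2 X),
        (Φ a : Ell2 Y →L[ℂ] Ell2 Y) (u v) = u ((a : Ell2 X →L[ℂ] Ell2 X) v))
    {p : uniformRoeAlgebra X} (hp : ∀ v : Ell2 Y, (∀ x, inner ℂ (u (delta x)) v = (0 : ℂ)) →
      (Φ p : Ell2 Y →L[ℂ] Ell2 Y) v = 0) (a : uniformRoeAlgebra X) :
    (Φ (a * p) : Ell2 Y →L[ℂ] Ell2 Y) =
      u.toContinuousLinearMap ∘L ((a * p : uniformRoeAlgebra X) : Ell2 X →L[ℂ] Ell2 X) ∘L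
        coisometry u := by
  ext1 v
  have h1 : (Φ p : Ell2 Y →L[ℂ] Ell2 Y) (v - u (coisometry u v)) = 0 := by
    refine hp _ fun x => ?_
    rw [inner_sub_right, LinearIsometry.inner_map_map, inner_delta, coisometry_apply, sub_self]
  rw [map_sub, sub_eq_zero, hΦ] at h1
  rw [map_mul]
  change (Φ a : Ell2 Y →L[ℂ] Ell2 Y) ((Φ p : Ell2 Y →L[ℂ] Ell2 Y) v) = _
  rw [h1, hΦ]
  rfl

end Subsequence

/-! ### Large coefficients give a uniformly finite-to-one coarse map. -/

section Coarse

variable {X Y : Type*}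

theorem tendsto_norm_apply_cofinite (v : Ell2 X) :
    Tendsto (fun x => ‖v x‖) cofinite (𝓝 0) := by
  have h := (hasSum_smul_delta v).summable.tendsto_cofinite_zero.norm
  simpa [norm_smul, orthonormal_delta.norm_eq_one] using h

theorem norm_coefficient_le_one (u : Ell2 X →ₗᵢ[ℂ] Ell2 Y) (x : X) (y : Y) :
    ‖u (delta x) y‖ ≤ 1 := by
  rw [← inner_delta]
  refine (norm_inner_le_norm _ _).trans ?_
  rw [orthonormal_delta.norm_eq_one, (orthonormal_isometry_delta u).norm_eq_one x, one_mul]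

/-- In Bessel's inequality for `δ_y`, each point of the fibre over `y` contributes at least δ². -/
theorem uniformlyFiniteToOne_of_coefficient_bound (u : Ell2 X →ₗᵢ[ℂ] Ell2 Y) {f : X → Y} {δ : ℝ}
    (hδ : 0 < δ) (hf : ∀ x, δ ≤ ‖u (delta x) (f x)‖) : UniformlyFiniteToOne f := by
  refine ⟨⌊1 / δ ^ 2⌋₊, fun y => ?_⟩
  by_contra! hcon
  obtain ⟨t, ht, hcard⟩ := Set.exists_subset_encard_eq (Order.add_one_le_of_lt hcon)
  have hfin : t.Finite := Set.finite_of_encard_eq_coe (k := ⌊1 / δ ^ 2⌋₊ + 1) (by simpa using hcard)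
  have h1 := (orthonormal_isometry_delta u).sum_inner_products_le (delta y) (s := hfin.toFinset)
  rw [orthonormal_delta.norm_eq_one] at h1
  have h2 : (hfin.toFinset.card : ℝ) * δ ^ 2 ≤ 1 := by
    refine le_trans ?_ (h1.trans_eq (one_pow 2))
    rw [← nsmul_eq_mul]
    refine Finset.card_nsmul_le_sum _ _ _ fun x hx => ?_
    have hxy : f x = y := ht (hfin.mem_toFinset.1 hx)
    rw [inner_delta_right, norm_star, ← hxy]
    exact pow_le_pow_left₀ hδ.le (hf x) 2
  have h3 : hfin.toFinset.card = ⌊1 / δ ^ 2⌋₊ + 1 := by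
    rw [hfin.encard_eq_coe_toFinset_card] at hcard
    exact_mod_cast hcard
  rw [← le_div_iff₀ (by positivity), h3] at h2
  push_cast at h2
  exact (Nat.lt_floor_add_one (1 / δ ^ 2)).not_ge h2

theorem UniformlyFiniteToOne.tendsto_cofinite {f : X → Y} (hf : UniformlyFiniteToOne f) :
    Tendsto f cofinite cofinite := by
  obtain ⟨k, hk⟩ := hf
  intro s hs
  rw [mem_cofinite] at hs
  rw [mem_map, mem_cofinite, ← Set.preimage_compl]
  exact hs.preimage' fun y _ => Set.finite_of_encard_le_coe (hk y)

variable [MetricSpace X] [MetricSpace Y]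

theorem UniformlyLocallyFinite.finite_closedBall (hX : UniformlyLocallyFinite X) (x : X) (r : ℝ) :
    (Metric.closedBall x r).Finite := by
  obtain ⟨N, hN⟩ := hX (max r 1) (by positivity)
  exact (Set.finite_of_encard_le_coe (hN x)).subset (Metric.closedBall_subset_closedBall (by simp))

theorem UniformlyLocallyFinite.countable (hX : UniformlyLocallyFinite X) : Countable X := by
  rcases isEmpty_or_nonempty X with h | ⟨⟨o⟩⟩
  · infer_instance
  · rw [← Set.countable_univ_iff, ← Metric.iUnion_closedBall_nat o]
    exact Set.countable_iUnion fun n => (hX.finite_closedBall o n).countable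

/-- Pairs of points at bounded distance with images at large distance can be chosen outside of any
finite sets. -/
theorem exists_pair_of_unbounded (hX : UniformlyLocallyFinite X) {f : X → Y} {r : ℝ}
    (hcon : ∀ s : ℝ, ∃ x x' : X, dist x x' ≤ r ∧ s < dist (f x) (f x')) {p p' : X → Prop}
    (hp : ∀ᶠ x in cofinite, p x) (hp' : ∀ᶠ x in cofinite, p' x) (s : ℝ) :
    ∃ x x' : X, dist x x' ≤ r ∧ s < dist (f x) (f x') ∧ p x ∧ p' x' := by
  rw [eventually_cofinite] at hp hp'
  have hfin : {q : X × X | dist q.1 q.2 ≤ r ∧ (¬p q.1 ∨ ¬p' q.2)}.Finite := by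
    have h1 := hp.biUnion (t := fun x => Prod.mk x '' Metric.closedBall x r)
      fun x _ => (hX.finite_closedBall x r).image _
    have h2 := hp'.biUnion (t := fun x => (fun z => (z, x)) '' Metric.closedBall x r)
      fun x _ => (hX.finite_closedBall x r).image _
    refine (h1.union h2).subset ?_
    rintro ⟨x, x'⟩ ⟨hd, h | h⟩
    · refine Or.inl (Set.mem_biUnion (x := x) h ⟨x', ?_, rfl⟩)
      rwa [Metric.mem_closedBall, dist_comm]
    · exact Or.inr (Set.mem_biUnion (x := x') h ⟨x, hd, rfl⟩)
  obtain ⟨M, hM⟩ := (hfin.image fun q => dist (f q.1) (f q.2)).bddAbove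
  obtain ⟨x, x', hd, hs⟩ := hcon (max M s)
  have hgood : ¬(¬p x ∨ ¬p' x') := fun h =>
    (lt_of_le_of_lt (le_max_left _ _) hs).not_ge (hM ⟨(x, x'), ⟨hd, h⟩, rfl⟩)
  rw [not_or, not_not, not_not] at hgood
  exact ⟨x, x', hd, (le_max_right _ _).trans_lt hs, hgood⟩

/-- A greedy choice. Coefficients of a fixed `u δ_x` vanish at infinity, also along the
finite-to-one `f`; at a fixed y, the coefficients of `u δ_x` vanish as x varies, being conjugate to
those of `u* δ_y`. -/
theorem exists_separated_pairs (hX : UniformlyLocallyFinite X) (u : Ell2 X →ₗᵢ[ℂ] Ell2 Y)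
    {f : X → Y} (hf : UniformlyFiniteToOne f) {r : ℝ}
    (hcon : ∀ s : ℝ, ∃ x x' : X, dist x x' ≤ r ∧ s < dist (f x) (f x')) {ε : ℝ} (hε : 0 < ε) :
    ∃ g g' : ℕ → X, g.Injective ∧ g'.Injective ∧ (∀ n, dist (g n) (g' n) ≤ r) ∧
      (∀ n : ℕ, (n : ℝ) < dist (f (g n)) (f (g' n))) ∧
      ∀ m n, m ≠ n → ‖u (delta (g m)) (f (g n))‖ ≤ ε * (1 / 2) ^ m := by
  -- The first component is a stage label; strictly increasing labels dominate the index, so bounds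
  -- in the label become bounds in the index.
  obtain ⟨G, hG, hG'⟩ := exists_seq_of_forall_finset_exists
    (fun q : ℕ × X × X => dist q.2.1 q.2.2 ≤ r ∧ (q.1 : ℝ) < dist (f q.2.1) (f q.2.2))
    (fun q q' : ℕ × X × X => q.1 < q'.1 ∧ q'.2.1 ≠ q.2.1 ∧ q'.2.2 ≠ q.2.2 ∧
      ‖u (delta q.2.1) (f q'.2.1)‖ ≤ ε * (1 / 2) ^ q.1 ∧
      ‖u (delta q'.2.1) (f q.2.1)‖ ≤ ε * (1 / 2) ^ q'.1) (by
    intro s _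
    set l := s.sup (fun q => q.1) + 1 with hl
    have h1 : ∀ᶠ z in cofinite, ∀ q ∈ s, z ≠ q.2.1 ∧
        ‖u (delta q.2.1) (f z)‖ ≤ ε * (1 / 2) ^ q.1 ∧
        ‖u (delta z) (f q.2.1)‖ ≤ ε * (1 / 2) ^ l := by
      refine (eventually_all_finset s).2 fun q _ => ?_
      have ha : ∀ᶠ z in cofinite, z ≠ q.2.1 := (Set.finite_singleton q.2.1).compl_mem_cofinite
      have hb := ((tendsto_norm_apply_cofinite (u (delta q.2.1))).comp
        hf.tendsto_cofinite).eventually_le_const (u := ε * (1 / 2) ^ q.1) (by positivity)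
      have hc := (tendsto_norm_apply_cofinite
        (coisometry u (delta (f q.2.1)))).eventually_le_const (u := ε * (1 / 2) ^ l) (by positivity)
      filter_upwards [ha, hb, hc] with z ha hb hc
      refine ⟨ha, hb, ?_⟩
      rwa [coisometry_apply, inner_delta_right, norm_star] at hc
    have h2 : ∀ᶠ z in cofinite, ∀ q ∈ s, z ≠ q.2.2 :=
      (eventually_all_finset s).2 fun q _ => (Set.finite_singleton q.2.2).compl_mem_cofinite
    obtain ⟨x, x', hd, hl', hx, hx'⟩ := exists_pair_of_unbounded hX hcon h1 h2 l
    refine ⟨(l, x, x'), ⟨hd, hl'⟩, fun q hq => ⟨?_, (hx q hq).1, hx' q hq, (hx q hq).2⟩⟩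
    exact Nat.lt_succ_of_le (Finset.le_sup (f := fun q : ℕ × X × X => q.1) hq))
  have hmono : StrictMono fun n => (G n).1 := fun m n hmn => (hG' m n hmn).1
  have hle : ∀ n, n ≤ (G n).1 := fun n => hmono.le_apply
  have hpow : ∀ n, ε * (1 / 2 : ℝ) ^ (G n).1 ≤ ε * (1 / 2) ^ n := fun n =>
    mul_le_mul_of_nonneg_left (pow_le_pow_of_le_one (by norm_num) (by norm_num) (hle n)) hε.le
  refine ⟨fun n => (G n).2.1, fun n => (G n).2.2, ?_, ?_, fun n => (hG n).1, fun n => ?_, ?_⟩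
  · exact Function.Injective.of_lt_imp_ne fun m n hmn => (hG' m n hmn).2.1.symm
  · exact Function.Injective.of_lt_imp_ne fun m n hmn => (hG' m n hmn).2.2.1.symm
  · exact lt_of_le_of_lt (Nat.cast_le.2 (hle n)) (hG n).2
  · intro m n hmn
    refine le_trans ?_ (hpow m)
    rcases lt_or_gt_of_ne hmn with h | h
    · exact (hG' m n h).2.2.2.1
    · exact (hG' n m h).2.2.2.2

theorem coisometry_comp {H K L : Type*} [NormedAddCommGroup H] [InnerProductSpace ℂ H]
    [CompleteSpace H] [NormedAddCommGroup K] [InnerProductSpace ℂ K] [CompleteSpace K]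
    [NormedAddCommGroup L] [InnerProductSpace ℂ L] [CompleteSpace L]
    (u : K →ₗᵢ[ℂ] L) (v : H →ₗᵢ[ℂ] K) :
    coisometry (u.comp v) = coisometry v ∘L coisometry u :=
  adjoint_comp u.toContinuousLinearMap v.toContinuousLinearMap

/-- If `f` is not coarse, Φ of the partial translation `g n ↦ g' n` has coefficients bounded below
at the arbitrarily distant pairs `f (g n)`, `f (g' n)`, which the Roe algebra forbids. -/
theorem isCoarse_of_coefficient_bound (hX : UniformlyLocallyFinite X) [Countable Y]
    {Φ : uniformRoeAlgebra X →⋆ₙₐ[ℂ] uniformRoeAlgebra Y} {u : Ell2 X →ₗᵢ[ℂ] Ell2 Y}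
    (hΦ : ∀ (a : uniformRoeAlgebra X) (v : Ell2 X),
      (Φ a : Ell2 Y →L[ℂ] Ell2 Y) (u v) = u ((a : Ell2 X →L[ℂ] Ell2 X) v))
    (hu : ∀ (x : X) (v : Ell2 Y), inner ℂ (u (delta x)) v = (0 : ℂ) →
      (Φ (rankOneRoe (delta x) (delta x)) : Ell2 Y →L[ℂ] Ell2 Y) v = 0)
    {f : X → Y} {δ : ℝ} (hδ : 0 < δ) (hf : ∀ x, δ ≤ ‖u (delta x) (f x)‖) : IsCoarse f := by
  intro r hr
  by_contra! hcon
  obtain ⟨g, g', hg, hg', hd, hfar, hsmall⟩ := exists_separated_pairs hX u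
    (uniformlyFiniteToOne_of_coefficient_bound u hδ hf) hcon (ε := δ ^ 2 / 4) (by positivity)
  obtain ⟨φ, hφ, hp⟩ := exists_subsequence_rangeProjection Φ u hu hg
  have hgφ := hg.comp hφ.injective
  have hgφ' := hg'.comp hφ.injective
  have hmap := map_mul_eq_of_annihilates hΦ hp
    (partialTranslation hgφ hgφ' hr fun i => hd (φ i))
  rw [partialTranslation_mul_rangeProjection] at hmap
  obtain ⟨s, hs⟩ := exists_norm_entry_lt
    (Φ (partialTranslation hgφ hgφ' hr fun i => hd (φ i))).2
    (ε := δ ^ 2 / 2) (by positivity)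
  obtain ⟨n, hn⟩ := exists_nat_gt s
  have hlt := hs (f (g (φ n))) (f (g' (φ n)))
    (hn.trans ((Nat.cast_le.2 (hφ.le_apply (x := n))).trans_lt (hfar (φ n))))
  set V := u.comp (deltaIsometry hgφ) with hV
  set V' := u.comp (deltaIsometry hgφ') with hV'
  have hVd : ∀ i, V (delta i) = u (delta (g (φ i))) := fun i => by
    simp [hV, deltaIsometry_delta]
  have hVd' : ∀ i, V' (delta i) = u (delta (g' (φ i))) := fun i => by
    simp [hV', deltaIsometry_delta]
  have hsum := hasSum_inner_isometry_coisometry V' V (delta (f (g' (φ n)))) (delta (f (g (φ n))))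
  have hentry : inner ℂ (delta (f (g' (φ n)))) (V' (coisometry V (delta (f (g (φ n)))))) =
      entry (Φ (partialTranslation hgφ hgφ' hr fun i => hd (φ i)) : Ell2 Y →L[ℂ] Ell2 Y)
        (f (g (φ n))) (f (g' (φ n))) := by
    rw [hmap, hV, coisometry_comp]
    rfl
  rw [hentry] at hsum
  -- The term of index `n` has modulus at least δ²; the others sum to at most (δ²/4)·2, leaving at
  -- least δ²/2.
  have hrest := hasSum_ite_sub_hasSum hsum n
  have hbound := hrest.norm_le_of_bounded (hasSum_geometric_two.mul_left (δ ^ 2 / 4)) (by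
    intro m
    split_ifs with hmn
    · simp only [norm_zero]; positivity
    · rw [hVd, hVd', inner_delta, inner_delta_right, norm_mul, norm_star]
      have h1 := norm_coefficient_le_one u (g' (φ m)) (f (g' (φ n)))
      have h2 := hsmall (φ m) (φ n) (hφ.injective.ne hmn)
      have h3 : (1 / 2 : ℝ) ^ φ m ≤ (1 / 2) ^ m :=
        pow_le_pow_of_le_one (by norm_num) (by norm_num) hφ.le_apply
      calc _ ≤ 1 * (δ ^ 2 / 4 * (1 / 2) ^ m) := by gcongr; exact h2.trans (by gcongr)
        _ = _ := one_mul _)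
  have hmain : δ ^ 2 ≤ ‖inner ℂ (delta (f (g' (φ n)))) (V' (delta n)) *
      inner ℂ (V (delta n)) (delta (f (g (φ n))))‖ := by
    rw [hVd, hVd', inner_delta, inner_delta_right, norm_mul, norm_star, sq]
    exact mul_le_mul (hf _) (hf _) hδ.le (norm_nonneg _)
  have htri := norm_sub_norm_le (inner ℂ (delta (f (g' (φ n)))) (V' (delta n)) *
      inner ℂ (V (delta n)) (delta (f (g (φ n)))))
    (entry (Φ (partialTranslation hgφ hgφ' hr fun i => hd (φ i)) : Ell2 Y →L[ℂ] Ell2 Y)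
        (f (g (φ n))) (f (g' (φ n))))
  rw [norm_sub_rev] at htri
  linarith

end Coarse

/-! ### Noncompact ghosts from vectors with small coefficients. -/

section Ghost

variable {X Y : Type*}

/-- Conjugating uu* back by `u` gives the identity of the infinite-dimensional ℓ₂(ℕ). -/
theorem not_isCompactOperator_isometry_coisometry {H : Type*} [NormedAddCommGroup H]
    [InnerProductSpace ℂ H] [CompleteSpace H] (u : Ell2 ℕ →ₗᵢ[ℂ] H) :
    ¬IsCompactOperator (u.toContinuousLinearMap ∘L coisometry u) := by
  intro h
  have h1 := (h.comp_clm u.toContinuousLinearMap).clm_comp (coisometry u)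
  have h2 : coisometry u ∘ (u.toContinuousLinearMap ∘L coisometry u) ∘ u.toContinuousLinearMap =
      id := by
    funext v
    change coisometry u (u (coisometry u (u v))) = v
    rw [coisometry_apply_isometry, coisometry_apply_isometry]
  rw [h2, isCompactOperator_id_iff_finiteDimensional (𝕜 := ℂ)] at h1
  exact not_finite_iff_infinite.2 inferInstance
    (orthonormal_delta (X := ℕ)).linearIndependent.finite

theorem isStarProjection_isometry_coisometry {H K : Type*} [NormedAddCommGroup H]
    [InnerProductSpace ℂ H] [CompleteSpace H] [NormedAddCommGroup K] [InnerProductSpace ℂ K]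
    [CompleteSpace K] (u : K →ₗᵢ[ℂ] H) :
    IsStarProjection (u.toContinuousLinearMap ∘L coisometry u) := by
  constructor
  · ext1 v
    change u (coisometry u (u (coisometry u v))) = u (coisometry u v)
    rw [coisometry_apply_isometry]
  · change adjoint (_ ∘L adjoint _) = _ ∘L adjoint _
    rw [adjoint_comp, adjoint_adjoint]

/-- An isometry whose canonical vectors have pairwise disjoint finite supports and coefficients
tending to zero has a ghost range projection. -/
theorem isGhost_isometry_coisometry (u : Ell2 ℕ →ₗᵢ[ℂ] Ell2 X) (F : ℕ → Set X)
    (hfin : ∀ n, (F n).Finite) (hdisj : Pairwise fun m n => Disjoint (F m) (F n))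
    (hsupp : ∀ n, ∀ x ∉ F n, u (delta n) x = 0)
    (hsmall : ∀ n x, ‖u (delta n) x‖ ≤ (1 / 2) ^ n) :
    IsGhost (u.toContinuousLinearMap ∘L coisometry u) := by
  intro ε hε
  obtain ⟨N, hN⟩ := exists_pow_lt_of_lt_one hε (by norm_num : (1 / 2 : ℝ) < 1)
  refine ⟨⋃ n ∈ Finset.range N, F n, (Finset.range N).finite_toSet.biUnion fun n _ => hfin n, ?_⟩
  -- Disjoint supports leave at most one term: its factor at `x` is small, and its factor at `y` is
  -- at most one.
  intro x y hx _
  have hsum : HasSum _ (entry (u.toContinuousLinearMap ∘L coisometry u) x y) :=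
    hasSum_inner_isometry_coisometry u u (delta y) (delta x)
  by_cases h : ∃ n, x ∈ F n
  · obtain ⟨n, hn⟩ := h
    have hnN : N ≤ n := by
      by_contra! hlt
      exact hx (Set.mem_biUnion (Finset.mem_coe.2 (Finset.mem_range.2 hlt)) hn)
    have h1 := hsum.unique (hasSum_single n fun m hm => by
      rw [inner_delta_right, hsupp m x fun hmx => Set.disjoint_left.1 (hdisj hm) hmx hn]
      simp)
    rw [h1, inner_delta, inner_delta_right, norm_mul, norm_star]
    calc ‖u (delta n) y‖ * ‖u (delta n) x‖ ≤ 1 * (1 / 2) ^ n := by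
          gcongr
          · exact norm_coefficient_le_one u n y
          · exact hsmall n x
      _ ≤ (1 / 2) ^ N := by
          rw [one_mul]
          exact pow_le_pow_of_le_one (by norm_num) (by norm_num) hnN
      _ < ε := hN
  · push Not at h
    have h1 : entry (u.toContinuousLinearMap ∘L coisometry u) x y = 0 := by
      refine hsum.unique ?_
      convert hasSum_zero with n
      rw [inner_delta_right, hsupp n x (h n)]
      simp
    rwa [h1, norm_zero]

/-- A unit vector with small coefficients is close to a finitely supported unit vector with small
coefficients and support outside of a given finite set. -/
theorem exists_finite_support_approx (ξ : Ell2 Y) (hξ : ‖ξ‖ = 1) (G : Finset Y) {ε δ : ℝ}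
    (hε : 0 < ε) (hε1 : ε ≤ 1) (hδ : δ ≤ ε / 2) (hGδ : G.card * δ ≤ ε / 8)
    (hsmall : ∀ y, ‖ξ y‖ < δ) :
    ∃ (F : Finset Y) (η : Ell2 Y), Disjoint F G ∧ ‖η‖ = 1 ∧ (∀ y ∉ F, η y = 0) ∧
      ‖ξ - η‖ ≤ ε ∧ ∀ y, ‖η y‖ ≤ ε := by
  classical
  -- Truncating to `F₀` costs ε/8 and deleting `G` at most ε/8. Normalising costs another ε/4 and at
  -- most doubles coefficients, whence δ ≤ ε/2.
  obtain ⟨F₀, hF₀, hGF₀⟩ := (((Metric.tendsto_nhds.1 (hasSum_smul_delta ξ)) (ε / 8)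
    (by positivity)).and (eventually_ge_atTop G)).exists
  set ζ : Ell2 Y := ∑ y ∈ F₀ \ G, ξ y • delta y with hζ
  have hζapp : ∀ y, ζ y = if y ∈ F₀ \ G then ξ y else 0 := by
    intro y
    rw [← inner_delta, hζ, inner_sum]
    simp [inner_smul_right, inner_delta, delta_apply]
  have hG : ‖∑ y ∈ G, ξ y • (delta y : Ell2 Y)‖ ≤ ε / 8 := by
    refine (norm_sum_le_of_le G (f := fun y => ξ y • (delta y : Ell2 Y)) (n := fun _ => δ)
      fun y _ => ?_).trans ?_
    · rw [norm_smul, orthonormal_delta.norm_eq_one, mul_one]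
      exact (hsmall y).le
    · simpa using hGδ
  have hsplit : ξ - ζ = (ξ - ∑ y ∈ F₀, ξ y • (delta y : Ell2 Y)) +
      ∑ y ∈ G, ξ y • (delta y : Ell2 Y) := by
    rw [← Finset.sum_sdiff hGF₀, ← hζ]
    abel
  have hξζ : ‖ξ - ζ‖ ≤ ε / 4 := by
    rw [hsplit]
    refine (norm_add_le _ _).trans ?_
    rw [dist_comm, dist_eq_norm] at hF₀
    linarith
  have hζ1 : |‖ζ‖ - 1| ≤ ε / 4 := by
    rw [← hξ, abs_sub_comm]
    exact (abs_norm_sub_norm_le _ _).trans hξζ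
  have hζ2 : 1 / 2 ≤ ‖ζ‖ := by
    have := (abs_le.1 hζ1).1
    linarith
  have hζ0 : ‖ζ‖ ≠ 0 := by linarith
  have hinv : ‖ζ‖⁻¹ ≤ 2 := by
    rw [inv_le_comm₀ (by linarith) two_pos]
    linarith
  refine ⟨F₀ \ G, ((‖ζ‖⁻¹ : ℝ) : ℂ) • ζ, Finset.sdiff_disjoint, ?_, ?_, ?_, ?_⟩
  · rw [norm_smul, Complex.norm_real, norm_inv, norm_norm, inv_mul_cancel₀ hζ0]
  · intro y hy
    rw [lp.coeFn_smul, Pi.smul_apply, hζapp, if_neg hy, smul_zero]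
  · have h1 : ζ - ((‖ζ‖⁻¹ : ℝ) : ℂ) • ζ = ((1 - ‖ζ‖⁻¹ : ℝ) : ℂ) • ζ := by
      push_cast
      rw [sub_smul, one_smul]
    have h2 : ‖ζ - ((‖ζ‖⁻¹ : ℝ) : ℂ) • ζ‖ ≤ ε / 4 := by
      rw [h1, norm_smul, Complex.norm_real, Real.norm_eq_abs]
      nth_rw 2 [← abs_of_nonneg (norm_nonneg ζ)]
      rwa [← abs_mul, sub_mul, one_mul, inv_mul_cancel₀ hζ0]
    refine (norm_sub_le_norm_sub_add_norm_sub _ ζ _).trans ?_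
    linarith
  · intro y
    rw [lp.coeFn_smul, Pi.smul_apply, norm_smul, Complex.norm_real, norm_inv, norm_norm, hζapp]
    split_ifs with hy
    · have := hsmall y
      calc _ ≤ 2 * δ := by gcongr
        _ ≤ ε := by linarith
    · simpa using hε.le

theorem orthonormal_of_disjoint_support {η : ℕ → Ell2 Y} (hη : ∀ n, ‖η n‖ = 1)
    {F : ℕ → Finset Y} (hF : Pairwise fun m n => Disjoint (F m) (F n))
    (hsupp : ∀ n, ∀ y ∉ F n, η n y = 0) : Orthonormal ℂ η := by
  refine ⟨hη, fun m n hmn => ?_⟩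
  refine (lp.inner_eq_tsum _ _).trans ?_
  refine (tsum_congr fun y => ?_).trans tsum_zero
  by_cases h1 : y ∈ F m
  · rw [hsupp n y (Finset.disjoint_left.1 (hF hmn) h1), inner_zero_right]
  · rw [hsupp m y h1, inner_zero_left]

variable [MetricSpace Y]

/-- If an orthonormal family contains vectors with arbitrarily small coefficients, then some of its
vectors are close to unit vectors with small coefficients and finite supports far apart. -/
theorem exists_separated_supports (hY : UniformlyLocallyFinite Y) {ξ : X → Ell2 Y}
    (hξ : ∀ x, ‖ξ x‖ = 1) (hcon : ∀ δ : ℝ, 0 < δ → ∃ x, ∀ y, ‖ξ x y‖ < δ) :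
    ∃ (g : ℕ → X) (F : ℕ → Finset Y) (η : ℕ → Ell2 Y), g.Injective ∧ (∀ n, ‖η n‖ = 1) ∧
      (∀ n, ∀ y ∉ F n, η n y = 0) ∧ (∀ n, ‖ξ (g n) - η n‖ ≤ (1 / 2) ^ n) ∧
      (∀ n y, ‖η n y‖ ≤ (1 / 2) ^ n) ∧
      ∀ m n, m < n → ∀ y ∈ F m, ∀ z ∈ F n, (n : ℝ) < dist y z := by
  classical
  have hne : ∀ x, ∃ y, 0 < ‖ξ x y‖ := by
    intro x
    by_contra! h
    have h0 : ξ x = 0 := by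
      ext y
      simpa using h y
    simpa [h0] using hξ x
  choose c hc using hne
  obtain ⟨G, hG, hG'⟩ := exists_seq_of_forall_finset_exists
    (fun q : ℕ × X × Finset Y × Ell2 Y => ‖q.2.2.2‖ = 1 ∧ (∀ y ∉ q.2.2.1, q.2.2.2 y = 0) ∧
      ‖ξ q.2.1 - q.2.2.2‖ ≤ (1 / 2) ^ q.1 ∧ ∀ y, ‖q.2.2.2 y‖ ≤ (1 / 2) ^ q.1)
    (fun q q' : ℕ × X × Finset Y × Ell2 Y => q.1 < q'.1 ∧ q.2.1 ≠ q'.2.1 ∧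
      ∀ y ∈ q.2.2.1, ∀ z ∈ q'.2.2.1, (q'.1 : ℝ) < dist y z) (by
    intro s _
    set l := s.sup (fun q => q.1) + 1 with hl
    set A : Finset Y := s.biUnion fun q => q.2.2.1.biUnion fun y =>
      (hY.finite_closedBall y l).toFinset with hA
    have hpos : (0 : ℝ) < (1 / 2) ^ l := by positivity
    -- `h1` and `h2` feed the approximation lemma, with `A` the `l`-neighbourhood of the earlier
    -- supports; `h3` forces a new point `x`, as each earlier vector has a coefficient at least δ.
    have h1 : ∀ᶠ δ : ℝ in 𝓝[>] 0, δ ≤ (1 / 2) ^ l / 2 :=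
      (eventually_le_nhds (by positivity)).filter_mono nhdsWithin_le_nhds
    have h2 : ∀ᶠ δ : ℝ in 𝓝[>] 0, A.card * δ ≤ (1 / 2) ^ l / 8 := by
      have : Tendsto (fun δ : ℝ => A.card * δ) (𝓝[>] 0) (𝓝 0) := by
        have := (tendsto_id (α := ℝ) (x := 𝓝 0)).const_mul (A.card : ℝ)
        rw [mul_zero] at this
        exact this.mono_left nhdsWithin_le_nhds
      exact this.eventually_le_const (by positivity)
    have h3 : ∀ᶠ δ : ℝ in 𝓝[>] 0, ∀ q ∈ s, δ ≤ ‖ξ q.2.1 (c q.2.1)‖ :=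
      (eventually_all_finset s).2 fun q _ =>
        (eventually_le_nhds (hc q.2.1)).filter_mono nhdsWithin_le_nhds
    obtain ⟨δ, h1, h2, h3, hδ⟩ :=
      (h1.and (h2.and (h3.and (self_mem_nhdsWithin : ∀ᶠ δ : ℝ in 𝓝[>] 0, 0 < δ)))).exists
    obtain ⟨x, hx⟩ := hcon δ hδ
    obtain ⟨F, η, hFA, hη1, hηF, hξη, hη⟩ := exists_finite_support_approx (ξ x) (hξ x) A hpos
      (pow_le_one₀ (by norm_num) (by norm_num)) h1 h2 hx
    refine ⟨(l, x, F, η), ⟨hη1, hηF, hξη, hη⟩, fun q hq => ⟨?_, ?_, fun y hy z hz => ?_⟩⟩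
    · exact Nat.lt_succ_of_le (Finset.le_sup (f := fun q : ℕ × X × Finset Y × Ell2 Y => q.1) hq)
    · intro h
      have := h3 q hq
      rw [h] at this
      exact (hx _).not_ge this
    · by_contra! hle
      refine Finset.disjoint_left.1 hFA hz ?_
      rw [hA, Finset.mem_biUnion]
      refine ⟨q, hq, Finset.mem_biUnion.2 ⟨y, hy, ?_⟩⟩
      rwa [Set.Finite.mem_toFinset, Metric.mem_closedBall, dist_comm])
  have hmono : StrictMono fun n => (G n).1 := fun m n hmn => (hG' m n hmn).1
  have hle : ∀ n, n ≤ (G n).1 := fun n => hmono.le_apply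
  have hpow : ∀ n, (1 / 2 : ℝ) ^ (G n).1 ≤ (1 / 2) ^ n := fun n =>
    pow_le_pow_of_le_one (by norm_num) (by norm_num) (hle n)
  exact ⟨fun n => (G n).2.1, fun n => (G n).2.2.1, fun n => (G n).2.2.2,
    Function.Injective.of_lt_imp_ne fun m n hmn => (hG' m n hmn).2.1, fun n => (hG n).1,
    fun n => (hG n).2.1, fun n => (hG n).2.2.1.trans (hpow n),
    fun n y => ((hG n).2.2.2 y).trans (hpow n), fun m n hmn y hy z hz =>
    (Nat.cast_le.2 (hle n)).trans_lt ((hG' m n hmn).2.2 y hy z hz)⟩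

/-- Membership in the uniform Roe algebra of the range projection of an isometry is stable under
summable perturbations. -/
theorem isometry_coisometry_mem_of_summable {W H : Ell2 ℕ →ₗᵢ[ℂ] Ell2 Y}
    (hW : W.toContinuousLinearMap ∘L coisometry W ∈ uniformRoeAlgebra Y)
    (hWH : Summable fun n => ‖W (delta n) - H (delta n)‖) :
    H.toContinuousLinearMap ∘L coisometry H ∈ uniformRoeAlgebra Y := by
  -- The two projections are only strong sums of rank one operators, but the differences are
  -- summable in norm, so their sum stays in the algebra.
  set D : ℕ → Ell2 Y →L[ℂ] Ell2 Y := fun n =>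
    rankOne ℂ (W (delta n)) (W (delta n)) - rankOne ℂ (H (delta n)) (H (delta n)) with hD
  have hbound : ∀ n, ‖D n‖ ≤ 2 * ‖W (delta n) - H (delta n)‖ := by
    intro n
    have h1 : D n = rankOne ℂ (W (delta n)) (W (delta n) - H (delta n)) +
        rankOne ℂ (W (delta n) - H (delta n)) (H (delta n)) := by
      ext1 v
      simp only [hD, sub_apply, add_apply, rankOne_apply, inner_sub_left, sub_smul, smul_sub]
      abel
    rw [h1]
    refine (norm_add_le _ _).trans ?_
    rw [norm_rankOne, norm_rankOne, (orthonormal_isometry_delta W).norm_eq_one n,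
      (orthonormal_isometry_delta H).norm_eq_one n]
    linarith
  have hsum := (Summable.of_norm_bounded (hWH.mul_left 2) hbound).hasSum
  have hmem : ∑' n, D n ∈ uniformRoeAlgebra Y := hasSum_mem_uniformRoeAlgebra hsum fun n =>
    sub_mem (rankOne_mem_uniformRoeAlgebra _ _) (rankOne_mem_uniformRoeAlgebra _ _)
  have heq : H.toContinuousLinearMap ∘L coisometry H =
      W.toContinuousLinearMap ∘L coisometry W - ∑' n, D n := by
    ext1 v
    have h1 := hsum.mapL (ContinuousLinearMap.apply ℂ (Ell2 Y) v)
    have h2 := (hasSum_isometry_coisometry W W v).sub (hasSum_isometry_coisometry H H v)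
    have h3 : (∑' n, D n) v = W (coisometry W v) - H (coisometry H v) := h1.unique h2
    rw [sub_apply, h3]
    change _ = W (coisometry W v) - _
    rw [sub_sub_cancel]
    rfl
  rw [heq]
  exact sub_mem hW hmem

theorem pairwise_disjoint_of_separated {F : ℕ → Finset Y}
    (hF : ∀ m n, m < n → ∀ y ∈ F m, ∀ z ∈ F n, (n : ℝ) < dist y z) :
    Pairwise fun m n => Disjoint (F m) (F n) := by
  refine (pairwise_disjoint_on _).2 fun m n hmn => Finset.disjoint_left.2 fun y hy hy' => ?_
  have := hF m n hmn y hy y hy'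
  rw [dist_self] at this
  exact (Nat.cast_nonneg n).not_gt this

theorem sparse_of_separated {F : ℕ → Finset Y}
    (hF : ∀ m n, m < n → ∀ y ∈ F m, ∀ z ∈ F n, (n : ℝ) < dist y z) :
    Sparse {y : Y | ∃ n, y ∈ F n} := by
  refine ⟨fun n => {y | (y : Y) ∈ F n}, fun n => ?_, ?_, ?_, fun R => ?_⟩
  · exact (F n).finite_toSet.preimage Subtype.val_injective.injOn
  · exact fun m n hmn => Set.disjoint_left.2 fun y hy hy' =>
      Finset.disjoint_left.1 (pairwise_disjoint_of_separated hF hmn) hy hy'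
  · exact Set.eq_univ_of_forall fun y => Set.mem_iUnion.2 y.2
  · obtain ⟨K, hK⟩ := exists_nat_ge R
    -- The larger of two indices with sum at least 2K is at least K, and it controls the distance.
    refine ⟨2 * K, fun n m hne hnm x hx y hy => ?_⟩
    rcases lt_or_gt_of_ne hne with h | h
    · have h1 : (K : ℝ) ≤ m := by exact_mod_cast (by omega : K ≤ m)
      exact (hK.trans h1).trans (hF n m h x hx y hy).le
    · have h1 : (K : ℝ) ≤ n := by exact_mod_cast (by omega : K ≤ n)
      rw [dist_comm]
      exact (hK.trans h1).trans (hF m n h y hy x hx).le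

/-- The range projection of an isometry whose canonical vectors have small coefficients and far
apart finite supports is a noncompact ghost on a sparse subspace. -/
theorem isometry_coisometry_notMem_of_separated
    (hghost : ∀ Y' : Set Y, Sparse Y' → YieldsOnlyCompactGhostProjections Y')
    {F : ℕ → Finset Y} (hF : ∀ m n, m < n → ∀ y ∈ F m, ∀ z ∈ F n, (n : ℝ) < dist y z)
    (H : Ell2 ℕ →ₗᵢ[ℂ] Ell2 Y) (hsupp : ∀ n, ∀ y ∉ F n, H (delta n) y = 0)
    (hsmall : ∀ n y, ‖H (delta n) y‖ ≤ (1 / 2) ^ n) :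
    H.toContinuousLinearMap ∘L coisometry H ∉ uniformRoeAlgebra Y := by
  intro hmem
  set S : Set Y := {y : Y | ∃ n, y ∈ F n} with hS
  have hsparse : Sparse S := sparse_of_separated hF
  set ι : Ell2 S →ₗᵢ[ℂ] Ell2 Y := deltaIsometry Subtype.val_injective with hι
  -- These vectors are supported in `S`, so restricting to ℓ₂(S) loses nothing and keeps them
  -- orthonormal.
  have hι' : ∀ n, ι (coisometry ι (H (delta n))) = H (delta n) := by
    intro n
    ext y
    rw [hι, deltaIsometry_coisometry_apply, Subtype.range_coe]
    by_cases hy : y ∈ S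
    · rw [Set.indicator_of_mem hy]
    · rw [Set.indicator_of_notMem hy, hsupp n y fun h => hy ⟨n, h⟩]
  have horth : Orthonormal ℂ fun n => coisometry ι (H (delta n)) := by
    classical
    rw [orthonormal_iff_ite]
    intro m n
    rw [← ι.inner_map_map, hι', hι']
    exact orthonormal_iff_ite.1 (orthonormal_isometry_delta H) m n
  set K := isometryOfOrthonormal horth with hK
  have hKd : ∀ n, K (delta n) = coisometry ι (H (delta n)) := isometryOfOrthonormal_delta horth
  have hKapp : ∀ n (y : S), K (delta n) y = H (delta n) (y : Y) := fun n y => by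
    rw [hKd, hι, coisometry_deltaIsometry_apply]
  have heq : coisometry ι ∘L (H.toContinuousLinearMap ∘L coisometry H) ∘L ι.toContinuousLinearMap =
      K.toContinuousLinearMap ∘L coisometry K := by
    ext1 v
    have h1 := (hasSum_isometry_coisometry H H (ι v)).mapL (coisometry ι)
    refine h1.unique ?_
    refine (hasSum_isometry_coisometry K K v).congr_fun ?_
    intro n
    rw [rankOne_apply, rankOne_apply, map_smul, hKd, ← ι.inner_map_map, hι']
  have hcomp := compression_mem_uniformRoeAlgebra S hmem ι (deltaIsometry_delta _)
  rw [heq] at hcomp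
  refine not_isCompactOperator_isometry_coisometry K (hghost S hsparse _ hcomp
    (isStarProjection_isometry_coisometry K) ?_)
  refine isGhost_isometry_coisometry K (fun n => {y | (y : Y) ∈ F n})
    (fun n => (F n).finite_toSet.preimage Subtype.val_injective.injOn) ?_
    (fun n y hy => (hKapp n y).trans (hsupp n y hy))
    fun n y => by rw [hKapp]; exact hsmall n y
  exact fun m n hmn => Set.disjoint_left.2 fun y hy hy' =>
    Finset.disjoint_left.1 (pairwise_disjoint_of_separated hF hmn) hy hy'

variable [MetricSpace X]

theorem exists_coefficient_bound (hY : UniformlyLocallyFinite Y)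
    (hghost : ∀ Y' : Set Y, Sparse Y' → YieldsOnlyCompactGhostProjections Y')
    {Φ : uniformRoeAlgebra X →⋆ₙₐ[ℂ] uniformRoeAlgebra Y} {u : Ell2 X →ₗᵢ[ℂ] Ell2 Y}
    (hΦ : ∀ (a : uniformRoeAlgebra X) (v : Ell2 X),
      (Φ a : Ell2 Y →L[ℂ] Ell2 Y) (u v) = u ((a : Ell2 X →L[ℂ] Ell2 X) v))
    (hu : ∀ (x : X) (v : Ell2 Y), inner ℂ (u (delta x)) v = (0 : ℂ) →
      (Φ (rankOneRoe (delta x) (delta x)) : Ell2 Y →L[ℂ] Ell2 Y) v = 0) :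
    ∃ δ : ℝ, 0 < δ ∧ ∀ x, ∃ y, δ ≤ ‖u (delta x) y‖ := by
  have := hY.countable
  by_contra! hcon
  obtain ⟨g, F, η, hg, hη1, hηF, hξη, hη, hF⟩ := exists_separated_supports hY
    (orthonormal_isometry_delta u).norm_eq_one hcon
  obtain ⟨φ, hφ, hp⟩ := exists_subsequence_rangeProjection Φ u hu hg
  have hgφ := hg.comp hφ.injective
  have hpow : ∀ n, (1 / 2 : ℝ) ^ φ n ≤ (1 / 2) ^ n := fun n =>
    pow_le_pow_of_le_one (by norm_num) (by norm_num) hφ.le_apply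
  -- With a = 1 this reads Φ(p) = upu* = WW*, which places WW* in the Roe algebra of `Y`.
  have hmap := map_mul_eq_of_annihilates hΦ hp 1
  rw [one_mul] at hmap
  set W := u.comp (deltaIsometry hgφ) with hW
  have hWmem : W.toContinuousLinearMap ∘L coisometry W ∈ uniformRoeAlgebra Y := by
    have h1 : W.toContinuousLinearMap ∘L coisometry W = Φ (rangeProjection hgφ) := by
      rw [hmap, hW, coisometry_comp]
      rfl
    rw [h1]
    exact SetLike.coe_mem _
  have hFφ : ∀ m n, m < n → ∀ y ∈ F (φ m), ∀ z ∈ F (φ n), (n : ℝ) < dist y z :=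
    fun m n hmn y hy z hz =>
      lt_of_le_of_lt (Nat.cast_le.2 hφ.le_apply) (hF _ _ (hφ hmn) y hy z hz)
  have horth : Orthonormal ℂ (η ∘ φ) :=
    (orthonormal_of_disjoint_support hη1 (pairwise_disjoint_of_separated hF) hηF).comp φ hφ.injective
  have hHd := isometryOfOrthonormal_delta horth
  refine isometry_coisometry_notMem_of_separated hghost hFφ (isometryOfOrthonormal horth)
    (fun n y hy => by rw [hHd]; exact hηF _ y hy)
    (fun n y => by rw [hHd]; exact (hη _ y).trans (hpow n))
    (isometry_coisometry_mem_of_summable hWmem ?_)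
  refine Summable.of_nonneg_of_le (fun _ => norm_nonneg _) (fun n => ?_) summable_geometric_two
  rw [hHd, hW, LinearIsometry.coe_comp, Function.comp_apply, deltaIsometry_delta]
  exact (hξη (φ n)).trans (hpow n)

end Ghost

end UniformRoe

end

theorem mainTheorem7 {X Y : Type*} [MetricSpace X] [MetricSpace Y]
    (hX : UniformRoe.UniformlyLocallyFinite X) (hY : UniformRoe.UniformlyLocallyFinite Y)
    (hghost : ∀ Y' : Set Y, UniformRoe.Sparse Y' →
      UniformRoe.YieldsOnlyCompactGhostProjections Y')
    (hemb : ∃ Φ : UniformRoe.uniformRoeAlgebra X →⋆ₙₐ[ℂ] UniformRoe.uniformRoeAlgebra Y,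
      Function.Injective Φ ∧ UniformRoe.RankPreserving Φ) :
    ∃ f : X → Y, UniformRoe.UniformlyFiniteToOne f ∧ UniformRoe.IsCoarse f := by
  obtain ⟨Φ, -, hΦ⟩ := hemb
  -- The isometry is built from a base point, so empty `X` is separate.
  rcases isEmpty_or_nonempty X with hemp | hne
  · exact ⟨isEmptyElim, ⟨0, fun y => by simp [Set.eq_empty_of_isEmpty]⟩,
      fun r _ => ⟨0, fun x => isEmptyElim x⟩⟩
  have := hY.countable
  obtain ⟨u, hint, hu⟩ := hΦ.exists_isometry
  obtain ⟨δ, hδ, hbound⟩ := UniformRoe.exists_coefficient_bound hY hghost hint hu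
  choose f hf using hbound
  exact ⟨f, UniformRoe.uniformlyFiniteToOne_of_coefficient_bound u hδ hf,
    UniformRoe.isCoarse_of_coefficient_bound hX hint hu hδ hf⟩
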